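/- Let $m,n,r,k$ be integers with $1\le m\le n$, $n\ge 3$, $r\ge 1$, $k\ge 0$. Hypergraphs may have repeated hyperedges; $K_n^h$ is the hypergraph on $n$ vertices whose hyperedges are all the $h$-subsets of the vertex set, each occurring once; $\lambda\mathcal G$ is obtained from $\mathcal G$ by replacing each hyperedge with $\lambda$ copies of it. The degree of a vertex is the number of hyperedges containing it, an $r$-factor is a spanning sub-hypergraph in which all vertices have degree $r$, and an $r$-factorization of $\mathcal G$ is a coloring of its hyperedges (with any number of colors) in which each color class is an $r$-factor. Let $V$ be a set of $m$ of the $n$ vertices of $\mathcal G=K_n^3$, let $$\mathcal F=K_m^3\cup (n-m)K_m^2\cup \tbinom{n-m}{2}K_m^1$$ on the vertex set $V$, and let a coloring of the hyperedges of $\mathcal F$ with colors $1,\dots,k$ be given; $\mathcal F(j)$ denotes the spanning sub-hypergraph of $\mathcal F$ formed by the hyperedges of color $j$, $d_{\mathcal F(j)}(v)$ the degree of $v$ in it, and $E^i(\mathcal F(j))$ the set of its hyperedges of size $i$. The coloring *extends to an $r$-factorization of $\mathcal G$* if there are an $r$-factorization of $\mathcal G$, whose colors include $1,\dots,k$, and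 an injective map from the hyperedges of $\mathcal F$ to those of $\mathcal G$ that preserves colors and sends each hyperedge $e$ to a hyperedge $e'$ with $e'\cap V=e$ (so $e'$ arises from $e$ by adding $3-|e|$ of the $n-m$ vertices outside $V$). **Theorem.** The given coloring of $\mathcal F$ extends to an $r$-factorization of $\mathcal G=K_n^3$ if and only if all of the following hold: 1. $3\mid rn$; 2. $r\mid\binom{n-1}{2}$; 3. $k=\binom{n-1}{2}/r$; 4. $d_{\mathcal F(j)}(v)=r$ for each $v\in V$ and $1\le j\le k$; 5. $|E^2(\mathcal F(j))|+2|E^3(\mathcal F(j))|\ge r\left(m-\frac n3\right)$ for $1\le j\le k$. -/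

import Mathlib

/-- A finite hypergraph with vertex set `V`, in which hyperedges may be repeated: a finite type of
hyperedges, each with the finite set of vertices that it joins. (No hyperedge contains a vertex
more than once, as is the case for all hypergraphs considered here.) -/
structure MultiHypergraph (V : Type) where
  /-- the hyperedges -/
  Edge : Type
  /-- there are finitely many hyperedges -/
  finite_edge : Finite Edge
  /-- the vertices joined by a hyperedge -/
  verts : Edge → Finset V

namespace MultiHypergraph

variable {V : Type}

instance (G : MultiHypergraph V) : Finite G.Edge := G.finite_edge

/-- The degree of a vertex: the number of hyperedges incident with it. -/
noncomputable def degree (G : MultiHypergraph V) (v : V) : ℕ :=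
  Nat.card {e : G.Edge // v ∈ G.verts e}

/-- `G` is `r`-regular if every vertex has degree `r`. -/
def IsRegular (G : MultiHypergraph V) (r : ℕ) : Prop :=
  ∀ v, G.degree v = r

/-- The number of hyperedges of size `i`. -/
noncomputable def numEdgesOfSize (G : MultiHypergraph V) (i : ℕ) : ℕ :=
  Nat.card {e : G.Edge // (G.verts e).card = i}

/-- The spanning sub-hypergraph `G(j)` formed by the hyperedges of color `j`. -/
def colorClass (G : MultiHypergraph V) {k : ℕ} (c : G.Edge → Fin k) (j : Fin k) :
    MultiHypergraph V where
  Edge := {e : G.Edge // c e = j}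
  finite_edge := inferInstance
  verts e := G.verts e.1

/-- The complete `h`-uniform hypergraph `K_n^h` on the vertices `Fin n`: every `h` distinct
vertices are joined by exactly one hyperedge. -/
def complete (n h : ℕ) : MultiHypergraph (Fin n) where
  Edge := {e : Finset (Fin n) // e.card = h}
  finite_edge := inferInstance
  verts e := e.1

/-- `l G`: every hyperedge of `G` is replaced with `l` copies of it. -/
def copies (l : ℕ) (G : MultiHypergraph V) : MultiHypergraph V where
  Edge := G.Edge × Fin l
  finite_edge := inferInstance
  verts e := G.verts e.1

/-- The union of two hypergraphs with the same vertices, whose hyperedges are kept apart. -/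
def union (G H : MultiHypergraph V) : MultiHypergraph V where
  Edge := G.Edge ⊕ H.Edge
  finite_edge := inferInstance
  verts := Sum.elim G.verts H.verts

/-- The hypergraph `K_m^3 ∪ (n-m) K_m^2 ∪ ((n-m) choose 2) K_m^1`, for `m ≤ n`. -/
def pieces (m n : ℕ) : MultiHypergraph (Fin m) :=
  ((complete m 3).union (copies (n - m) (complete m 2))).union
    (copies ((n - m).choose 2) (complete m 1))

/-- The coloring `c` of `G` is an `r`-factorization: each color class is an `r`-factor of `G`, i.e.
an `r`-regular spanning sub-hypergraph. (The hyperedge sets of the color classes partition the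
hyperedges of `G`.) -/
def IsFactorization (G : MultiHypergraph V) (r : ℕ) {q : ℕ} (c : G.Edge → Fin q) : Prop :=
  ∀ j, (G.colorClass c j).IsRegular r

/-- The injection `ext` enlarges each hyperedge of `F` to a hyperedge of `G` by adding vertices
outside the vertex set of `F`, which is identified with a set of vertices of `G` through `i`. -/
structure IsEnlargement {W : Type} (i : V ↪ W) (F : MultiHypergraph V) (G : MultiHypergraph W)
    (ext : F.Edge → G.Edge) : Prop where
  injective : Function.Injective ext
  trace : ∀ e v, i v ∈ G.verts (ext e) ↔ v ∈ F.verts e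

/-- The `k`-hyperedge-coloring `c` of the pieces on the first `m` of `n` vertices extends to an
`r`-factorization of `K_n^3`: the pieces can be enlarged, each keeping its color, to
hyperedges of some colored `K_n^3` in which every color class is an `r`-factor. The
`r`-factorization is not required in advance to have only the `k` given colors. -/
def ExtendsToFactorization {m n k : ℕ} (hmn : m ≤ n) (r : ℕ) (c : (pieces m n).Edge → Fin k) :
    Prop :=
  ∃ (q : ℕ) (hkq : k ≤ q) (c' : (complete n 3).Edge → Fin q)
    (ext : (pieces m n).Edge → (complete n 3).Edge),
    IsFactorization (complete n 3) r c' ∧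
    IsEnlargement (Fin.castLEEmb hmn) (pieces m n) (complete n 3) ext ∧
    ∀ e, c' (ext e) = Fin.castLE hkq (c e)

end MultiHypergraph

/-!
Necessity is a count. The hyperedges of `K_n^3` that meet the first `m` vertices are as many as the
hyperedges of `pieces m n`, so an enlargement reaches all of them
(`MultiHypergraph.IsEnlargement.exists_eq`). Hence every color occurs among the given ones, the
degrees at the first `m` vertices are those of the factors, and no color has more pieces than the
`r n / 3` hyperedges of an `r`-factor. Given the degrees, the last bound is equivalent to the
inequality on the numbers of pieces of sizes 2 and 3
(`MultiHypergraph.three_mul_card_colorClass_le_iff`).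

For sufficiency, empty hyperedges are added until each color has `r n / 3` hyperedges; there are
`(n - m).choose 3` of them in all, and the hyperedges are now the traces on the first `m` vertices of
a colored `K_n^3` that is still to be found. The remaining vertices are then introduced one at a
time, in the manner of Baranyai's theorem. With `t` vertices present, each set `e` of at most three
of them is the trace of `(n - t).choose (3 - #e)` hyperedges and each color has degree `r` at each of
them (`IsAmalgam`). If every hyperedge with trace `e` receives the next vertex with weight
`(3 - #e) / (n - t)`, then each trace and each color has an integral total weight, the total of each
color being `r`. A bipartite rounding lemma (`exists_finset_card_fiber_eq_sum`, from Hall's theorem)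
replaces these weights by an actual set of hyperedges with the same totals, and enlarging its members
by the new vertex preserves the invariant (`IsAmalgam.exists_succ`). Once `t = n`, every triple
occurs exactly once and nothing else occurs.
-/

/-! ### Rounding weights along two partitions -/

open Finset in
theorem Finset.sum_le_sum_image_sum_fiber {S C : Type*} [Fintype S] [DecidableEq C]
    (X : Finset S) (h : S → C) {w : S → ℚ} (hw : ∀ s, 0 ≤ w s) :
    ∑ s ∈ X, w s ≤ ∑ c ∈ X.image h, ∑ s with h s = c, w s := by
  rw [← sum_fiberwise_of_maps_to (fun s hs ↦ mem_image_of_mem h hs)]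
  exact sum_le_sum fun c _ ↦ sum_le_sum_of_subset_of_nonneg
    (filter_subset_filter _ (subset_univ _)) fun s _ _ ↦ hw s

open Finset in
/-- Weights in `[0, 1]` whose totals over the fibers of `f` and of `g` are integers can be rounded to
the indicator of a set, with the same totals. Each element is matched either with one of the places
for selected elements in its fiber of `g`, or with one of the places for rejected elements in its
fiber of `f`; the weights are a fractional matching, which gives Hall's condition. -/
theorem exists_finset_card_fiber_eq_sum {S A B : Type*} [Fintype S] [Fintype A] [Fintype B]
    [DecidableEq A] [DecidableEq B] (f : S → A) (g : S → B) (w : S → ℚ)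
    (h0 : ∀ s, 0 ≤ w s) (h1 : ∀ s, w s ≤ 1)
    (hf : ∀ a, ∃ p : ℕ, ∑ s with f s = a, w s = p)
    (hg : ∀ b, ∃ q : ℕ, ∑ s with g s = b, w s = q) :
    ∃ I : Finset S, (∀ a, (#{s ∈ I | f s = a} : ℚ) = ∑ s with f s = a, w s) ∧
      ∀ b, (#{s ∈ I | g s = b} : ℚ) = ∑ s with g s = b, w s := by
  classical
  choose p hp using hf
  choose q hq using hg
  have hpN (a : A) : p a ≤ #{s | f s = a} := by
    have : (p a : ℚ) ≤ #{s | f s = a} := by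
      rw [← hp, card_eq_sum_ones, Nat.cast_sum]
      exact sum_le_sum fun s _ ↦ by simpa using h1 s
    exact_mod_cast this
  let t : S → Finset ((Σ b : B, Fin (q b)) ⊕ (Σ a : A, Fin (#{s | f s = a} - p a))) := fun s ↦
    (({g s} : Finset B).sigma fun _ ↦ univ).disjSum (({f s} : Finset A).sigma fun _ ↦ univ)
  obtain ⟨φ, hφ, hφt⟩ := (all_card_le_biUnion_card_iff_exists_injective t).1 fun X ↦ by
    have hX : X.biUnion t =
        ((X.image g).sigma fun _ ↦ univ).disjSum ((X.image f).sigma fun _ ↦ univ) := by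
      ext (x | x) <;> simp [t, eq_comm]
    have e1 := X.sum_le_sum_image_sum_fiber g h0
    have e2 := X.sum_le_sum_image_sum_fiber f (w := fun s ↦ 1 - w s) fun s ↦ sub_nonneg.2 (h1 s)
    simp only [sum_sub_distrib, hp, hq, sum_const, nsmul_eq_mul, mul_one] at e1 e2
    rw [hX, card_disjSum, card_sigma, card_sigma]
    simp only [card_univ, Fintype.card_fin]
    have : (#X : ℚ) ≤ ∑ b ∈ X.image g, (q b : ℚ) +
        ∑ a ∈ X.image f, ((#{s | f s = a} - p a : ℕ) : ℚ) := by
      simp only [Nat.cast_sub (hpN _), sum_sub_distrib]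
      linarith
    exact_mod_cast this
  -- The selected elements are those matched with a place in their fiber of `g`.
  let I : Finset S := {s | (φ s).isLeft}
  have hIg (b : B) : #{s ∈ I | g s = b} ≤ q b := by
    have := card_le_card_of_injOn (s := {s ∈ I | g s = b})
      (t := (({b} : Finset B).sigma fun b ↦ (univ : Finset (Fin (q b)))).disjSum
        (∅ : Finset (Σ a : A, Fin (#{s | f s = a} - p a)))) φ
      (fun s hs ↦ by
        have h := hφt s
        simp only [coe_filter, Set.mem_ofPred_eq, I, mem_filter_univ] at hs
        rcases h' : φ s with x | x
        · rw [h'] at h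
          simpa [t, hs.2] using h
        · simp [h'] at hs) hφ.injOn
    simpa using this
  have hIf (a : A) : p a ≤ #{s ∈ I | f s = a} := by
    have := card_le_card_of_injOn (s := ({s | f s = a} : Finset S).filter (· ∉ I))
      (t := (∅ : Finset (Σ b : B, Fin (q b))).disjSum
        (({a} : Finset A).sigma fun a ↦ (univ : Finset (Fin (#{s | f s = a} - p a))))) φ
      (fun s hs ↦ by
        have h := hφt s
        simp only [coe_filter, Set.mem_ofPred_eq, I, mem_filter_univ] at hs
        rcases h' : φ s with x | x
        · simp [h'] at hs
        · rw [h'] at h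
          simpa [t, hs.1] using h) hφ.injOn
    have hsplit := card_filter_add_card_filter_not (s := ({s | f s = a} : Finset S)) (· ∈ I)
    have e1 : (({s | f s = a} : Finset S).filter (· ∈ I)) = {s ∈ I | f s = a} := by
      ext; simp [and_comm]
    rw [e1] at hsplit
    simp only [card_disjSum, card_empty, card_sigma, sum_singleton, card_univ, Fintype.card_fin,
      zero_add] at this
    have := hpN a
    omega
  -- Both families of inequalities sum to `#I`, so they are equalities.
  have hpq : ∑ a, p a = ∑ b, q b := by
    have : (∑ a, (p a : ℚ)) = ∑ b, (q b : ℚ) := by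
      simp only [← hp, ← hq, sum_fiberwise]
    exact_mod_cast this
  have sf : ∑ a, #{s ∈ I | f s = a} = #I :=
    (card_eq_sum_card_fiberwise fun _ _ ↦ mem_coe.2 (mem_univ _)).symm
  have sg : ∑ b, #{s ∈ I | g s = b} = #I :=
    (card_eq_sum_card_fiberwise fun _ _ ↦ mem_coe.2 (mem_univ _)).symm
  have lf := sum_le_sum fun a (_ : a ∈ univ) ↦ hIf a
  have lg := sum_le_sum fun b (_ : b ∈ univ) ↦ hIg b
  refine ⟨I, fun a ↦ ?_, fun b ↦ ?_⟩
  · rw [hp, (sum_eq_sum_iff_of_le fun a _ ↦ hIf a).1 (by omega) a (mem_univ a)]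
  · rw [hq, (sum_eq_sum_iff_of_le fun b _ ↦ hIg b).1 (by omega) b (mem_univ b)]

/-! ### Introducing the vertices one at a time -/

open Finset in
/-- The hyperedges `s : S`, colored by `col`, have traces `T s` on the first `t` of `n` vertices that
have the multiplicities and degrees of the traces of an `r`-factorization of `K_n^3`. The hyperedges
are a fixed type and only their traces vary with `t`, so that each hyperedge can be followed
through the construction. -/
structure IsAmalgam {S : Type*} [Fintype S] {n k : ℕ} (r t : ℕ) (col : S → Fin k)
    (T : S → Finset (Fin n)) : Prop where
  /-- the traces consist of the first `t` vertices -/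
  lt : ∀ s, ∀ v ∈ T s, v.val < t
  /-- no trace has more than three vertices -/
  card_le : ∀ s, #(T s) ≤ 3
  /-- each possible trace occurs as often as in `K_n^3` -/
  card_fiber : ∀ e : Finset (Fin n), (∀ v ∈ e, v.val < t) → #e ≤ 3 →
    #{s | T s = e} = (n - t).choose (3 - #e)
  /-- each color has `r n / 3` hyperedges -/
  card_color : ∀ j, 3 * #{s | col s = j} = r * n
  /-- each color has degree `r` at each of the first `t` vertices -/
  degree : ∀ v : Fin n, v.val < t → ∀ j, #{s | col s = j ∧ v ∈ T s} = r

namespace IsAmalgam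

open Finset

variable {S : Type*} [Fintype S] {n k r t : ℕ} {col : S → Fin k} {T : S → Finset (Fin n)}

theorem sum_card (h : IsAmalgam r t col T) (ht : t ≤ n) (j : Fin k) :
    ∑ s with col s = j, #(T s) = r * t := by
  have h1 := sum_card_bipartiteAbove_eq_sum_card_bipartiteBelow
    (s := ({s | col s = j} : Finset S)) (t := ({v | v.val < t} : Finset (Fin n)))
    (fun s v ↦ v ∈ T s)
  have h2 (s : S) : bipartiteAbove (fun s v ↦ v ∈ T s)
      ({v | v.val < t} : Finset (Fin n)) s = T s := by
    ext v
    simpa [bipartiteAbove] using h.lt s v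
  simp only [h2] at h1
  rw [h1, sum_congr rfl (g := fun _ ↦ r), sum_const, smul_eq_mul, mul_comm]
  · congr 1
    have : ({v | v.val < t} : Finset (Fin n)) = univ.map (Fin.castLEEmb ht) := by
      ext v
      simp only [mem_filter_univ, mem_map, mem_univ, true_and, Fin.castLEEmb_apply]
      exact ⟨fun hv ↦ ⟨⟨v, hv⟩, rfl⟩, by rintro ⟨a, rfl⟩; exact a.2⟩
    rw [this]
    simp
  · intro v hv
    rw [mem_filter_univ] at hv
    rw [← h.degree v hv j, bipartiteBelow, filter_filter]

/-- A trace lacks at most as many vertices as are still to come, since otherwise its prescribed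
multiplicity would be zero. -/
theorem card_le_sub (h : IsAmalgam r t col T) (s : S) : 3 - #(T s) ≤ n - t := by
  by_contra! hlt
  have := h.card_fiber (T s) (h.lt s) (h.card_le s)
  rw [Nat.choose_eq_zero_of_lt hlt, card_eq_zero] at this
  exact filter_eq_empty_iff.1 this (mem_univ s) rfl

/-- The hyperedges that are to contain the next vertex: a proportion `(3 - #e) / (n - t)` of those
with trace `e`, and `r` of each color. -/
theorem exists_selection (h : IsAmalgam r t col T) (ht : t < n) :
    ∃ I : Finset S, (∀ e, #{s ∈ I | T s = e} * (n - t) = #{s | T s = e} * (3 - #e)) ∧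
      ∀ j, #{s ∈ I | col s = j} = r := by
  have hpos : (0 : ℚ) < n - t := sub_pos.2 (by exact_mod_cast ht)
  have hle (s : S) : ((3 : ℚ) - #(T s)) ≤ n - t := by
    have := h.card_le_sub s
    have h3 := h.card_le s
    have : 3 + t ≤ n + #(T s) := by omega
    have : (3 + t : ℚ) ≤ n + #(T s) := by exact_mod_cast this
    linarith
  have hrow (e : Finset (Fin n)) : ∑ s with T s = e, ((3 : ℚ) - #(T s)) / (n - t) =
      #{s | T s = e} * (3 - #e) / (n - t) := by
    rw [sum_congr rfl (g := fun _ ↦ ((3 : ℚ) - #e) / (n - t)), sum_const, nsmul_eq_mul,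
      mul_div_assoc]
    intro s hs
    rw [(mem_filter_univ s).1 hs]
  have hcol (j : Fin k) : ∑ s with col s = j, ((3 : ℚ) - #(T s)) / (n - t) = r := by
    rw [← sum_div, sum_sub_distrib, sum_const, nsmul_eq_mul, ← Nat.cast_sum,
      h.sum_card ht.le, div_eq_iff hpos.ne']
    have : (3 * #{s | col s = j} : ℚ) = r * n := by exact_mod_cast h.card_color j
    push_cast
    linarith
  -- Sets that are not admissible as traces have empty fibers.
  have hne (e : Finset (Fin n)) (he : ¬ ((∀ v ∈ e, v.val < t) ∧ #e ≤ 3)) :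
      #{s | T s = e} = 0 := by
    rw [card_eq_zero, filter_eq_empty_iff]
    rintro s - rfl
    exact he ⟨h.lt s, h.card_le s⟩
  obtain ⟨I, hI, hI'⟩ := exists_finset_card_fiber_eq_sum T col
    (fun s ↦ ((3 : ℚ) - #(T s)) / (n - t))
    (fun s ↦ div_nonneg (sub_nonneg.2 (by exact_mod_cast h.card_le s)) hpos.le)
    (fun s ↦ (div_le_one hpos).2 (hle s))
    (fun e ↦ by
      simp only [hrow]
      by_cases he : (∀ v ∈ e, v.val < t) ∧ #e ≤ 3
      · rw [h.card_fiber e he.1 he.2]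
        obtain ⟨N, hN⟩ : ∃ N, n - t = N + 1 := ⟨n - t - 1, by omega⟩
        have hN' : (n - t : ℚ) = N + 1 := by
          rw [← Nat.cast_sub ht.le, hN]; push_cast; rfl
        have h3 : (3 - #e : ℚ) = (3 - #e : ℕ) := by rw [Nat.cast_sub he.2]; rfl
        rw [hN', hN, h3]
        rcases 3 - #e with _ | i
        · exact ⟨0, by simp⟩
        -- `(N + 1).choose (i + 1) * (i + 1) / (N + 1) = N.choose i`
        · refine ⟨N.choose i, ?_⟩
          rw [div_eq_iff (by positivity)]
          have := Nat.add_one_mul_choose_eq N i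
          rw [mul_comm] at this
          exact_mod_cast this.symm
      · exact ⟨0, by simp [hne e he]⟩)
    (fun j ↦ ⟨r, hcol j⟩)
  refine ⟨I, fun e ↦ ?_, fun j ↦ ?_⟩
  · by_cases he : (∀ v ∈ e, v.val < t) ∧ #e ≤ 3
    · have := hI e
      rw [hrow, eq_div_iff hpos.ne'] at this
      have h3 : (3 - #e : ℚ) = (3 - #e : ℕ) := by rw [Nat.cast_sub he.2]; rfl
      rw [h3, ← Nat.cast_sub ht.le] at this
      exact_mod_cast this
    · have h0 : #{s ∈ I | T s = e} = 0 :=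
        Nat.le_zero.1 ((card_le_card (filter_subset_filter _ (subset_univ _))).trans (hne e he).le)
      rw [h0, hne e he]
      simp
  · have := hI' j
    rw [hcol] at this
    exact_mod_cast this

theorem exists_succ (h : IsAmalgam r t col T) (ht : t < n) :
    ∃ T' : S → Finset (Fin n), IsAmalgam r (t + 1) col T' ∧
      ∀ s (v : Fin n), v.val < t → (v ∈ T' s ↔ v ∈ T s) := by
  classical
  obtain ⟨I, hI, hI'⟩ := h.exists_selection ht
  let x : Fin n := ⟨t, ht⟩
  have hx (s : S) : x ∉ T s := fun hs ↦ lt_irrefl t (h.lt s x hs)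
  let T' : S → Finset (Fin n) := fun s ↦ if s ∈ I then insert x (T s) else T s
  have hxT (s : S) : x ∈ T' s ↔ s ∈ I := by
    by_cases hs : s ∈ I <;> simp [T', hs, hx]
  have herase (s : S) : (T' s).erase x = T s := by
    by_cases hs : s ∈ I <;> simp [T', hs, hx]
  have hvT (s : S) (v : Fin n) (hv : v.val < t) : v ∈ T' s ↔ v ∈ T s := by
    have : v ≠ x := by rintro rfl; exact lt_irrefl t hv
    rw [← herase s, mem_erase, and_iff_right this]
  -- The proportion `b / (n - t)` of `(n - t).choose b`.
  have hmul (a b : ℕ) : a * (n - t) = (n - t).choose b * b →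
      a = if b = 0 then 0 else (n - (t + 1)).choose (b - 1) := by
    intro hab
    have hnt : n - t = n - (t + 1) + 1 := by omega
    rcases b with _ | b
    · simpa [hnt] using hab
    · rw [hnt, ← Nat.add_one_mul_choose_eq, mul_comm] at hab
      simpa using Nat.eq_of_mul_eq_mul_left (Nat.succ_pos _) hab
  refine ⟨T', ⟨?_, ?_, ?_, h.card_color, ?_⟩, hvT⟩
  · intro s v hv
    by_cases hvx : v = x
    · simp [hvx, x]
    · exact (h.lt s v (herase s ▸ mem_erase.2 ⟨hvx, hv⟩)).trans (Nat.lt_succ_self t)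
  · intro s
    by_cases hs : s ∈ I
    -- A trace of size 3 has weight zero, so its hyperedges are not selected.
    · have h3 : #(T s) ≠ 3 := by
        intro h3
        have := hI (T s)
        rw [h3, Nat.sub_self, mul_zero, Nat.mul_eq_zero, or_iff_left (by omega),
          card_eq_zero] at this
        exact filter_eq_empty_iff.1 this hs rfl
      have := h.card_le s
      simp only [T', hs, if_true, card_insert_of_notMem (hx s)]
      omega
    · simpa [T', hs] using h.card_le s
  · intro e he he3
    have hlt (v : Fin n) (hv : v ∈ e.erase x) : v.val < t := by
      have h1 := he v (mem_of_mem_erase hv)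
      have h2 : v.val ≠ t := fun h2 ↦ ne_of_mem_erase hv (Fin.ext h2)
      omega
    have key := hmul _ _ ((hI (e.erase x)).trans
      (by rw [h.card_fiber _ hlt ((card_erase_le).trans he3)]))
    by_cases hxe : x ∈ e
    · have : ({s | T' s = e} : Finset S) = {s ∈ I | T s = e.erase x} := by
        ext s
        simp only [mem_filter, mem_univ, true_and, ← hxT s, ← herase s]
        constructor
        · rintro rfl; exact ⟨hxe, rfl⟩
        · rintro ⟨h1, h2⟩; rw [← insert_erase h1, h2, insert_erase hxe]
      have hpos : 0 < #e := card_pos.2 ⟨x, hxe⟩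
      rw [this, key, card_erase_of_mem hxe, if_neg (by omega)]
      congr 1
      omega
    · have : ({s | T' s = e} : Finset S) = ({s | T s = e} : Finset S) \ {s ∈ I | T s = e} := by
        ext s
        by_cases hs : s ∈ I
        · simp only [mem_sdiff, mem_filter, mem_univ, hs, true_and, and_not_self, iff_false]
          rintro rfl
          exact hxe ((hxT s).2 hs)
        · simp [hs, T']
      rw [erase_eq_of_notMem hxe] at key hlt
      rw [this, card_sdiff_of_subset (filter_subset_filter _ (subset_univ _)),
        h.card_fiber e hlt he3, key]
      have hnt : n - t = n - (t + 1) + 1 := by omega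
      rw [hnt]
      rcases 3 - #e with _ | b
      · simp
      · simp [Nat.choose_succ_succ]
  · intro v hv j
    by_cases hvx : v = x
    · rw [← hI' j]
      congr 1
      ext s
      simp [hvx, hxT, and_comm]
    · have hvt : v.val < t := by
        have h2 : v.val ≠ t := fun h2 ↦ hvx (Fin.ext h2)
        omega
      simpa only [hvT _ _ hvt] using h.degree v hvt j

theorem exists_final {m : ℕ} (h : IsAmalgam r m col T) (hmn : m ≤ n) :
    ∃ T' : S → Finset (Fin n), IsAmalgam r n col T' ∧
      ∀ s (v : Fin n), v.val < m → (v ∈ T' s ↔ v ∈ T s) := by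
  suffices ∀ t, m ≤ t → t ≤ n → ∃ T' : S → Finset (Fin n), IsAmalgam r t col T' ∧
      ∀ s (v : Fin n), v.val < m → (v ∈ T' s ↔ v ∈ T s) from this n hmn le_rfl
  intro t hmt
  induction t, hmt using Nat.le_induction with
  | base => exact fun _ ↦ ⟨T, h, fun _ _ _ ↦ Iff.rfl⟩
  | succ t hmt ih =>
    intro ht
    obtain ⟨T₁, h₁, hT₁⟩ := ih (by omega)
    obtain ⟨T₂, h₂, hT₂⟩ := h₁.exists_succ ht
    exact ⟨T₂, h₂, fun s v hv ↦ (hT₂ s v (hv.trans_le hmt)).trans (hT₁ s v hv)⟩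

end IsAmalgam

/-! ### Counting hyperedges by color, vertex and size -/

namespace MultiHypergraph

open Finset

section General

variable {V : Type} (G : MultiHypergraph V) {k : ℕ} (c : G.Edge → Fin k) (j : Fin k)

theorem degree_colorClass [Fintype G.Edge] [DecidableEq V] (v : V) :
    (G.colorClass c j).degree v = #{e | c e = j ∧ v ∈ G.verts e} := by
  rw [← Fintype.card_subtype, ← Nat.card_eq_fintype_card]
  exact Nat.card_congr (Equiv.subtypeSubtypeEquivSubtypeInter (c · = j) (v ∈ G.verts ·))

theorem numEdgesOfSize_colorClass [Fintype G.Edge] (i : ℕ) :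
    (G.colorClass c j).numEdgesOfSize i = #{e | c e = j ∧ #(G.verts e) = i} := by
  rw [← Fintype.card_subtype, ← Nat.card_eq_fintype_card]
  exact Nat.card_congr (Equiv.subtypeSubtypeEquivSubtypeInter (c · = j) (fun e ↦ #(G.verts e) = i))

theorem sum_degree_colorClass [Fintype G.Edge] [Fintype V] [DecidableEq V] :
    ∑ v, (G.colorClass c j).degree v = ∑ e with c e = j, #(G.verts e) := by
  have h := sum_card_bipartiteAbove_eq_sum_card_bipartiteBelow
    (s := ({e | c e = j} : Finset G.Edge)) (t := (univ : Finset V)) (fun e v ↦ v ∈ G.verts e)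
  simp only [bipartiteAbove, bipartiteBelow, filter_mem_eq_inter, univ_inter, filter_filter] at h
  simp only [degree_colorClass, h]

variable {G c j}

theorem card_colorClass_eq [Fintype G.Edge] (hG : ∀ e, #(G.verts e) ∈ Icc 1 3) :
    #{e | c e = j} = (G.colorClass c j).numEdgesOfSize 1 +
      (G.colorClass c j).numEdgesOfSize 2 + (G.colorClass c j).numEdgesOfSize 3 := by
  rw [card_eq_sum_card_fiberwise (f := fun e ↦ #(G.verts e)) (t := Icc 1 3) fun e _ ↦ hG e]
  simp only [numEdgesOfSize_colorClass, filter_filter]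
  rw [show Icc 1 3 = ({1, 2, 3} : Finset ℕ) from rfl]
  simp [add_assoc]

theorem sum_card_verts_colorClass [Fintype G.Edge] (hG : ∀ e, #(G.verts e) ∈ Icc 1 3) :
    ∑ e with c e = j, #(G.verts e) = (G.colorClass c j).numEdgesOfSize 1 +
      2 * (G.colorClass c j).numEdgesOfSize 2 + 3 * (G.colorClass c j).numEdgesOfSize 3 := by
  rw [← sum_fiberwise_of_maps_to (g := fun e ↦ #(G.verts e)) (t := Icc 1 3) fun e _ ↦ hG e]
  simp only [numEdgesOfSize_colorClass, filter_filter]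
  have (i : ℕ) : ∑ e with c e = j ∧ #(G.verts e) = i, #(G.verts e) =
      i * #{e | c e = j ∧ #(G.verts e) = i} := by
    rw [mul_comm, ← smul_eq_mul, ← sum_const]
    exact sum_congr rfl fun e he ↦ (mem_filter.1 he).2.2
  simp only [this]
  rw [show Icc 1 3 = ({1, 2, 3} : Finset ℕ) from rfl]
  simp [add_assoc]

end General

/-! ### The hypergraphs `pieces m n` and `K_n^3` -/

section Pieces

variable {m n : ℕ}

theorem card_verts_pieces (e : (pieces m n).Edge) : #((pieces m n).verts e) ∈ Icc 1 3 := by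
  rcases e with (⟨e, he⟩ | ⟨⟨e, he⟩, _⟩) | ⟨⟨e, he⟩, _⟩ <;>
    simp [pieces, union, copies, complete, he]

theorem card_edge_complete (n h : ℕ) : Nat.card (complete n h).Edge = n.choose h := by
  change Nat.card {e : Finset (Fin n) // #e = h} = _
  rw [Nat.card_eq_fintype_card, Fintype.card_finset_len, Fintype.card_fin]

/-- Vandermonde's identity: the pieces account for all triples except those that avoid the first `m`
vertices. -/
theorem card_edge_pieces (hmn : m ≤ n) :
    Nat.card (pieces m n).Edge + (n - m).choose 3 = n.choose 3 := by
  have : Nat.card (pieces m n).Edge = m.choose 3 + m.choose 2 * (n - m) + m * (n - m).choose 2 := by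
    change Nat.card (((complete m 3).Edge ⊕ (complete m 2).Edge × Fin (n - m)) ⊕
      (complete m 1).Edge × Fin ((n - m).choose 2)) = _
    simp only [Nat.card_sum, Nat.card_prod, card_edge_complete, Nat.card_fin, Nat.choose_one_right]
  rw [this]
  obtain ⟨d, rfl⟩ := Nat.exists_eq_add_of_le hmn
  rw [Nat.add_choose_eq, Nat.add_sub_cancel_left]
  simp [Nat.antidiagonal_succ]
  ring

theorem card_complete_verts_eq (h : ℕ) (s : Finset (Fin m)) :
    Nat.card {e : (complete m h).Edge // (complete m h).verts e = s} = if #s = h then 1 else 0 := by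
  split_ifs with hs
  · rw [Nat.card_eq_one_iff_unique]
    exact ⟨⟨fun a b ↦ Subtype.ext (Subtype.ext (a.2.trans b.2.symm))⟩, ⟨⟨⟨s, hs⟩, rfl⟩⟩⟩
  · have : IsEmpty {e : (complete m h).Edge // (complete m h).verts e = s} :=
      ⟨fun a ↦ hs (a.2 ▸ a.1.2)⟩
    exact Nat.card_of_isEmpty

theorem card_copies_verts_eq {V : Type} (l : ℕ) (G : MultiHypergraph V) (s : Finset V) :
    Nat.card {e : (copies l G).Edge // (copies l G).verts e = s} =
      Nat.card {e : G.Edge // G.verts e = s} * l := by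
  refine (Nat.card_congr (Equiv.prodSubtypeFstEquivSubtypeProd (β := Fin l)
    (p := fun e : G.Edge ↦ G.verts e = s))).trans ?_
  rw [Nat.card_prod, Nat.card_fin]

theorem card_union_verts_eq {V : Type} (G H : MultiHypergraph V) (s : Finset V) :
    Nat.card {e : (G.union H).Edge // (G.union H).verts e = s} =
      Nat.card {e : G.Edge // G.verts e = s} + Nat.card {e : H.Edge // H.verts e = s} := by
  rw [← Nat.card_sum]
  exact Nat.card_congr (Equiv.subtypeSum (p := fun e ↦ (G.union H).verts e = s))

theorem card_pieces_verts_eq [Fintype (pieces m n).Edge] (s : Finset (Fin m))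
    (hs : #s ∈ Icc 1 3) :
    #{e : (pieces m n).Edge | (pieces m n).verts e = s} = (n - m).choose (3 - #s) := by
  rw [← Fintype.card_subtype, ← Nat.card_eq_fintype_card, pieces, card_union_verts_eq,
    card_union_verts_eq, card_copies_verts_eq, card_copies_verts_eq]
  simp only [card_complete_verts_eq]
  rw [show Icc 1 3 = ({1, 2, 3} : Finset ℕ) from rfl] at hs
  simp only [mem_insert, mem_singleton] at hs
  rcases hs with h | h | h <;> simp [h]

end Pieces

section Complete

variable {n : ℕ}

theorem three_mul_card_colorClass_complete [Fintype (complete n 3).Edge] {r q : ℕ}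
    {c : (complete n 3).Edge → Fin q} (h : IsFactorization (complete n 3) r c) (j : Fin q) :
    3 * #{e | c e = j} = r * n := by
  have h1 := sum_degree_colorClass (complete n 3) c j
  rw [sum_congr rfl fun v _ ↦ h j v, sum_congr rfl fun e _ ↦ show
    #((complete n 3).verts e) = 3 from e.2] at h1
  simp only [sum_const, smul_eq_mul, card_univ, Fintype.card_fin] at h1
  linarith

theorem three_mul_choose_three (hn : 1 ≤ n) : 3 * n.choose 3 = n * (n - 1).choose 2 := by
  obtain ⟨n, rfl⟩ := Nat.exists_eq_add_of_le' hn
  rw [Nat.add_sub_cancel, Nat.add_one_mul_choose_eq, mul_comm]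

theorem card_colors_mul [Fintype (complete n 3).Edge] {r q : ℕ} (hn : 1 ≤ n)
    {c : (complete n 3).Edge → Fin q} (h : IsFactorization (complete n 3) r c) :
    q * r = (n - 1).choose 2 := by
  have h1 : ∑ j, #{e | c e = j} = n.choose 3 := by
    rw [← card_edge_complete, Nat.card_eq_fintype_card, ← card_univ]
    exact (card_eq_sum_card_fiberwise fun _ _ ↦ mem_coe.2 (mem_univ _)).symm
  have h2 := three_mul_choose_three hn
  rw [← h1, mul_sum, sum_congr rfl fun j _ ↦ three_mul_card_colorClass_complete h j] at h2
  simp only [sum_const, smul_eq_mul, card_univ, Fintype.card_fin] at h2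
  exact Nat.eq_of_mul_eq_mul_left hn (by linarith)

end Complete

/-! ### Necessity of the conditions -/

section Necessity

variable {m n r k : ℕ} {hmn : m ≤ n}

/-- Every triple that meets the first `m` vertices is the enlargement of a piece: the triples that
arise are of this kind, and they are equally many. -/
theorem IsEnlargement.exists_eq {ext : (pieces m n).Edge → (complete n 3).Edge}
    (h : IsEnlargement (Fin.castLEEmb hmn) (pieces m n) (complete n 3) ext)
    (s : (complete n 3).Edge) (v : Fin m) (hv : Fin.castLEEmb hmn v ∈ (complete n 3).verts s) :
    ∃ e, ext e = s := by
  classical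
  have := Fintype.ofFinite (pieces m n).Edge
  have := Fintype.ofFinite (complete n 3).Edge
  let X : Finset (Fin n) := univ.map (Fin.castLEEmb hmn)
  -- The triples disjoint from the first `m` vertices.
  let Y : Finset (complete n 3).Edge := {s | Disjoint ((complete n 3).verts s) X}
  have hY : #Y = (n - m).choose 3 := by
    have hX : #Xᶜ = n - m := by simp [X, card_compl]
    rw [← hX, ← card_powersetCard]
    refine card_bij (fun s _ ↦ s.1) (fun s hs ↦ ?_) (fun _ _ _ _ h ↦ Subtype.ext h) fun b hb ↦ ?_
    · exact mem_powersetCard.2 ⟨subset_compl_iff_disjoint_right.2 (mem_filter.1 hs).2, s.2⟩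
    · rw [mem_powersetCard] at hb
      exact ⟨⟨b, hb.2⟩, mem_filter.2 ⟨mem_univ _, subset_compl_iff_disjoint_right.1 hb.1⟩, rfl⟩
  have hsub : univ.image ext ⊆ Yᶜ := by
    intro s hs
    obtain ⟨e, -, rfl⟩ := mem_image.1 hs
    obtain ⟨v, hv⟩ := card_pos.1 (mem_Icc.1 (card_verts_pieces e)).1
    rw [mem_compl, mem_filter, not_and, disjoint_right]
    exact fun _ hd ↦ hd (mem_map_of_mem _ (mem_univ v)) ((h.trace e v).2 hv)
  have heq := eq_of_subset_of_card_le hsub (by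
    have h1 := card_edge_pieces hmn
    rw [Nat.card_eq_fintype_card] at h1
    rw [card_compl, hY, card_image_of_injective _ h.injective, card_univ,
      ← Nat.card_eq_fintype_card (α := (complete n 3).Edge), card_edge_complete]
    omega)
  have hs : s ∈ Yᶜ := by
    rw [mem_compl, mem_filter, not_and, disjoint_right]
    exact fun _ hd ↦ hd (mem_map_of_mem _ (mem_univ v)) hv
  rw [← heq] at hs
  simpa using hs

theorem ExtendsToFactorization.necessary [Fintype (pieces m n).Edge] (hm : 1 ≤ m) (hn : 3 ≤ n)
    (hr : 1 ≤ r) {c : (pieces m n).Edge → Fin k} (h : ExtendsToFactorization hmn r c) :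
    3 ∣ r * n ∧ k * r = (n - 1).choose 2 ∧
      (∀ v j, ((pieces m n).colorClass c j).degree v = r) ∧
      ∀ j, 3 * #{e | c e = j} ≤ r * n := by
  obtain ⟨q, hkq, c', ext, hc', hext, hcol⟩ := h
  have := Fintype.ofFinite (complete n 3).Edge
  obtain rfl : k = q := by
    refine hkq.antisymm ?_
    -- Every color occurs at a vertex of the small set, hence on an enlarged hyperedge.
    have hsurj : Function.Surjective (Fin.castLE hkq) := by
      intro j
      have hd := hc' j (Fin.castLEEmb hmn ⟨0, hm⟩)
      rw [degree_colorClass] at hd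
      obtain ⟨s, hs⟩ := card_pos.1 (hr.trans hd.ge)
      rw [mem_filter] at hs
      obtain ⟨e, rfl⟩ := hext.exists_eq s _ hs.2.2
      exact ⟨c e, (hcol e).symm.trans hs.2.1⟩
    simpa using Fintype.card_le_of_surjective _ hsurj
  replace hcol (e) : c' (ext e) = c e := hcol e
  have hk := card_colors_mul (by omega) hc'
  refine ⟨?_, hk, fun v j ↦ ?_, fun j ↦ ?_⟩
  · have hkpos : 0 < k := by
      refine Nat.pos_of_ne_zero fun h0 ↦ ?_
      rw [h0, zero_mul] at hk
      exact (Nat.choose_pos (show 2 ≤ n - 1 by omega)).ne hk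
    exact ⟨_, (three_mul_card_colorClass_complete hc' ⟨0, hkpos⟩).symm⟩
  · rw [← hc' j (Fin.castLEEmb hmn v), degree_colorClass, degree_colorClass]
    refine card_bij (fun e _ ↦ ext e) (fun e he ↦ ?_) (fun _ _ _ _ h ↦ hext.injective h)
      fun s hs ↦ ?_
    · rw [mem_filter] at he ⊢
      exact ⟨mem_univ _, (hcol e).trans he.2.1, (hext.trace e v).2 he.2.2⟩
    · rw [mem_filter] at hs
      obtain ⟨e, rfl⟩ := hext.exists_eq s v hs.2.2
      exact ⟨e, mem_filter.2 ⟨mem_univ _, (hcol e).symm.trans hs.2.1,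
        (hext.trace e v).1 hs.2.2⟩, rfl⟩
  · rw [← three_mul_card_colorClass_complete hc' j]
    refine Nat.mul_le_mul_left _ (card_le_card_of_injOn ext (fun e he ↦ ?_) hext.injective.injOn)
    have := (mem_filter.1 (mem_coe.1 he)).2
    simp [hcol, this]

end Necessity

/-! ### Sufficiency of the conditions -/

section Sufficiency

variable {m n r k : ℕ} {hmn : m ≤ n}

theorem _root_.Finset.card_filter_sum {A B : Type*} [Fintype A] [Fintype B] {p : A ⊕ B → Prop}
    {q : A → Prop} {q' : B → Prop} [DecidablePred p] [DecidablePred q] [DecidablePred q']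
    (hq : ∀ a, p (.inl a) ↔ q a) (hq' : ∀ b, p (.inr b) ↔ q' b) :
    #{s | p s} = #{a | q a} + #{b | q' b} := by
  simp only [card_filter, Fintype.sum_sum_type, hq, hq']

/-- When all `n` vertices are present, every triple is the trace of exactly one hyperedge, and the
colors of these hyperedges form an `r`-factorization. -/
theorem extendsToFactorization_of_isAmalgam {S : Type} [Fintype S] {col : S → Fin k}
    {T : S → Finset (Fin n)} (h : IsAmalgam r n col T) {c : (pieces m n).Edge → Fin k}
    {i : (pieces m n).Edge → S} (hi : Function.Injective i) (hc : ∀ e, col (i e) = c e)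
    (hT : ∀ e v, Fin.castLEEmb hmn v ∈ T (i e) ↔ v ∈ (pieces m n).verts e) :
    ExtendsToFactorization hmn r c := by
  classical
  have := Fintype.ofFinite (complete n 3).Edge
  have hcard (s : S) : #(T s) = 3 := by
    have h1 := h.card_le_sub s
    have h2 := h.card_le s
    omega
  let Φ : S → (complete n 3).Edge := fun s ↦ ⟨T s, hcard s⟩
  have hΦ : Function.Bijective Φ := by
    have hone (e : (complete n 3).Edge) : #{s | T s = e.1} = 1 := by
      simpa [e.2] using h.card_fiber e.1 (fun v _ ↦ v.2) e.2.le
    refine ⟨fun s s' hs ↦ ?_, fun e ↦ ?_⟩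
    · exact card_le_one.1 (hone (Φ s')).le s (mem_filter.2 ⟨mem_univ _, congrArg Subtype.val hs⟩)
        s' (mem_filter.2 ⟨mem_univ _, rfl⟩)
    · obtain ⟨s, hs⟩ := card_pos.1 (hone e).ge
      exact ⟨s, Subtype.ext (mem_filter.1 hs).2⟩
  let Ψ := Equiv.ofBijective Φ hΦ
  refine ⟨k, le_rfl, fun e ↦ col (Ψ.symm e), fun e ↦ Ψ (i e), fun j v ↦ ?_,
    ⟨Ψ.injective.comp hi, hT⟩, fun e ↦ ?_⟩
  · rw [degree_colorClass, ← h.degree v v.2 j]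
    symm
    refine card_bij (fun s _ ↦ Ψ s) (fun s hs ↦ ?_) (fun _ _ _ _ h ↦ Ψ.injective h) fun e he ↦ ?_
    · rw [mem_filter] at hs ⊢
      exact ⟨mem_univ _, (congrArg col (Ψ.symm_apply_apply s)).trans hs.2.1, hs.2.2⟩
    · obtain ⟨s, rfl⟩ := Ψ.surjective e
      rw [mem_filter] at he
      exact ⟨s, mem_filter.2 ⟨mem_univ _,
        (congrArg col (Ψ.symm_apply_apply s)).symm.trans he.2.1, he.2.2⟩, rfl⟩
  · simp [hc]

theorem extendsToFactorization_of_le [Fintype (pieces m n).Edge] (hn : 1 ≤ n)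
    {c : (pieces m n).Edge → Fin k} (hrn : 3 ∣ r * n) (hk : k * r = (n - 1).choose 2)
    (hdeg : ∀ v j, ((pieces m n).colorClass c j).degree v = r)
    (hle : ∀ j, 3 * #{e | c e = j} ≤ r * n) : ExtendsToFactorization hmn r c := by
  classical
  obtain ⟨N, hN⟩ := hrn
  have hleN (j) : #{e | c e = j} ≤ N := by
    have := hle j
    omega
  -- In each color, as many empty traces are added as hyperedges are missing.
  let Extra := Σ j, Fin (N - #{e | c e = j})
  have hExtra : Fintype.card Extra = (n - m).choose 3 := by
    have h1 : ∑ j, #{e | c e = j} = Fintype.card (pieces m n).Edge :=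
      (card_eq_sum_card_fiberwise fun _ _ ↦ mem_coe.2 (mem_univ _)).symm
    have h2 : Fintype.card Extra + ∑ j, #{e | c e = j} = k * N := by
      simp only [Extra, Fintype.card_sigma, Fintype.card_fin, ← sum_add_distrib,
        Nat.sub_add_cancel (hleN _), sum_const, card_univ, smul_eq_mul]
    have h3 := card_edge_pieces hmn
    rw [Nat.card_eq_fintype_card] at h3
    have h4 : k * N = n.choose 3 := by
      refine Nat.eq_of_mul_eq_mul_left three_pos ?_
      rw [three_mul_choose_three hn, ← hk]
      calc 3 * (k * N) = k * (3 * N) := by ring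
        _ = n * (k * r) := by rw [← hN]; ring
    omega
  have hX : IsAmalgam (S := (pieces m n).Edge ⊕ Extra) (n := n) r m (Sum.elim c Sigma.fst)
      (Sum.elim (fun e ↦ ((pieces m n).verts e).map (Fin.castLEEmb hmn)) fun _ ↦ ∅) := by
    refine ⟨?_, ?_, ?_, fun j ↦ ?_, fun v hv j ↦ ?_⟩
    · rintro (e | e) v hv
      · obtain ⟨a, -, rfl⟩ := mem_map.1 hv
        exact a.2
      · simp at hv
    · rintro (e | e)
      · simpa using (mem_Icc.1 (card_verts_pieces e)).2
      · simp
    · intro s hs hs3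
      obtain ⟨s, rfl⟩ : ∃ s' : Finset (Fin m), s'.map (Fin.castLEEmb hmn) = s := by
        refine ⟨univ.filter fun a ↦ Fin.castLEEmb hmn a ∈ s, ?_⟩
        ext v
        simp only [mem_map, mem_filter_univ]
        exact ⟨by rintro ⟨a, ha, rfl⟩; exact ha, fun hv ↦ ⟨⟨v, hs v hv⟩, hv, rfl⟩⟩
      rw [card_map] at hs3 ⊢
      refine (card_filter_sum (q := fun e ↦ (pieces m n).verts e = s) (q' := fun _ ↦ s = ∅)
        (fun _ ↦ by exact map_inj) fun _ ↦ by exact eq_comm.trans map_eq_empty).trans ?_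
      obtain rfl | hne := s.eq_empty_or_nonempty
      · have : ({e | (pieces m n).verts e = ∅} : Finset (pieces m n).Edge) = ∅ := by
          rw [filter_eq_empty_iff]
          intro e _ he
          simpa [he] using card_verts_pieces e
        simp [this, hExtra]
      · rw [card_pieces_verts_eq s (mem_Icc.2 ⟨hne.card_pos, hs3⟩),
          filter_false_of_mem fun _ _ ↦ hne.ne_empty, card_empty, add_zero]
    · have : #{b : Extra | b.1 = j} = N - #{e | c e = j} := by
        rw [← Fintype.card_subtype, Fintype.card_congr (Equiv.sigmaSubtype j), Fintype.card_fin]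
      rw [card_filter_sum (q := fun e ↦ c e = j) (q' := fun b : Extra ↦ b.1 = j)
        (fun _ ↦ Iff.rfl) fun _ ↦ Iff.rfl, this, Nat.add_sub_cancel' (hleN j), hN]
    · refine (card_filter_sum (q := fun e ↦ c e = j ∧ ⟨v, hv⟩ ∈ (pieces m n).verts e)
        (q' := fun _ ↦ False)
        (fun _ ↦ and_congr_right fun _ ↦ by exact mem_map' (a := ⟨v, hv⟩) (Fin.castLEEmb hmn))
        fun _ ↦ iff_of_false (fun h ↦ notMem_empty _ h.2) id).trans ?_
      rw [filter_false, card_empty, add_zero, ← hdeg ⟨v, hv⟩ j, degree_colorClass]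
  obtain ⟨T, hT, hTv⟩ := hX.exists_final hmn
  refine extendsToFactorization_of_isAmalgam hT Sum.inl_injective (fun _ ↦ rfl) fun e v ↦ ?_
  rw [hTv _ _ v.2]
  simp

end Sufficiency

/-! ### The inequality on the numbers of pieces -/

/-- Since the sizes of the pieces of color `j` add up to `r m`, the number `e₂ + 2 e₃` is `r m` minus
the number of pieces of this color. -/
theorem three_mul_card_colorClass_le_iff {m n r k : ℕ} [Fintype (pieces m n).Edge]
    {c : (pieces m n).Edge → Fin k} {j : Fin k}
    (hdeg : ∀ v, ((pieces m n).colorClass c j).degree v = r) :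
    3 * #{e | c e = j} ≤ r * n ↔
      (((pieces m n).colorClass c j).numEdgesOfSize 2 : ℝ) +
        2 * (((pieces m n).colorClass c j).numEdgesOfSize 3 : ℝ) ≥
      (r : ℝ) * ((m : ℝ) - (n : ℝ) / 3) := by
  have h1 := card_colorClass_eq (c := c) (j := j) card_verts_pieces
  have h2 := sum_card_verts_colorClass (c := c) (j := j) card_verts_pieces
  rw [← sum_degree_colorClass, sum_congr rfl fun v _ ↦ hdeg v] at h2
  simp only [sum_const, smul_eq_mul, card_univ, Fintype.card_fin] at h2
  have h2' := congrArg (Nat.cast (R := ℝ)) h2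
  rw [h1, ← Nat.cast_le (α := ℝ)]
  push_cast at h2' ⊢
  constructor <;> intro h <;> linarith

end MultiHypergraph

theorem theorem4p1 (m n r k : ℕ) (hm : 1 ≤ m) (hmn : m ≤ n) (hn : 3 ≤ n) (hr : 1 ≤ r)
    (c : (MultiHypergraph.pieces m n).Edge → Fin k) :
    MultiHypergraph.ExtendsToFactorization hmn r c ↔
      3 ∣ r * n ∧
      r ∣ (n - 1).choose 2 ∧
      k = (n - 1).choose 2 / r ∧
      (∀ (v : Fin m) (j : Fin k),
        ((MultiHypergraph.pieces m n).colorClass c j).degree v = r) ∧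
      (∀ j : Fin k,
        (((MultiHypergraph.pieces m n).colorClass c j).numEdgesOfSize 2 : ℝ) +
            2 * (((MultiHypergraph.pieces m n).colorClass c j).numEdgesOfSize 3 : ℝ) ≥
          (r : ℝ) * ((m : ℝ) - (n : ℝ) / 3)) := by
  have := Fintype.ofFinite (MultiHypergraph.pieces m n).Edge
  constructor
  · intro h
    obtain ⟨h1, h2, h3, h4⟩ := h.necessary hm hn hr
    exact ⟨h1, ⟨k, by rw [← h2, mul_comm]⟩, by rw [← h2, Nat.mul_div_cancel k hr], h3, fun j ↦
      (MultiHypergraph.three_mul_card_colorClass_le_iff fun v ↦ h3 v j).1 (h4 j)⟩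
  · rintro ⟨h1, h2, rfl, h3, h4⟩
    exact MultiHypergraph.extendsToFactorization_of_le (by omega) h1 (Nat.div_mul_cancel h2) h3
      fun j ↦ (MultiHypergraph.three_mul_card_colorClass_le_iff fun v ↦ h3 v j).2 (h4 j)
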